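/- For a weakly decreasing sequence of nonnegative integers $\alpha=(\alpha_1,\dots,\alpha_k)$ let $$s_\alpha=\sum_T\ \prod_{i\ge 1}x_i^{m(i,T)}\in\mathbb Z[[x_1,x_2,\dots]]$$ be the Schur function, where $T$ runs over all semistandard Young tableaux of shape $\alpha$ with entries in $\{1,2,\dots\}$ and $m(i,T)$ is the number of entries of $T$ equal to $i$ (so $s_\alpha=1$ for the empty sequence); for every other finite integer sequence $\alpha$ put $s_\alpha=0$. Let $s^{[2,\infty)}_\alpha$ denote the power series obtained from $s_\alpha$ by setting $x_1=0$. Theorem. Let $k\ge 1$, let $\lambda=(\lambda_1,\dots,\lambda_k)$ be a partition (that is, $\lambda_1\ge\dots\ge\lambda_k\ge 0$ are integers), and let $0\le t\le k-1$. Then $$s_\lambda\, s^{[2,\infty)}_{(\lambda_1,\dots,\lambda_t,\,\lambda_{t+2}-1,\dots,\lambda_k-1)} = s^{[2,\infty)}_\lambda\, s_{(\lambda_1,\dots,\lambda_t,\,\lambda_{t+2}-1,\dots,\lambda_k-1)} + x_1\, s_{(\lambda_1-1,\dots,\lambda_k-1)}\, s^{[2,\infty)}_{(\lambda_1+1,\dots,\lambda_t+1,\,\lambda_{t+2},\dots,\lambda_k)}.$$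 -/

import Mathlib

/-- A finite sequence of integers `(α_1, …, α_k)` is a partition (trailing zeros allowed) if it is
weakly decreasing with nonnegative entries. -/
def IsPartition {k : ℕ} (α : Fin k → ℤ) : Prop :=
  Antitone α ∧ ∀ i, 0 ≤ α i

/-- The Young diagram with row lengths `α_1, …, α_k`. -/
def IsPartition.shape {k : ℕ} {α : Fin k → ℤ} (h : IsPartition α) : YoungDiagram :=
  YoungDiagram.ofRowLens (List.ofFn fun i => (α i).toNat)
    (List.sortedGE_ofFn_iff.mpr fun _ _ hij => Int.toNat_le_toNat (h.1 hij))

/-- The semistandard Young tableaux `T` of shape `Y` with positive entries that have content `d`,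
that is, `x^T = ∏ i, x_i ^ d i`: the entry `i` occurs exactly `d i` times in `T`, for all `i ≥ 1`.
(Mathlib's tableaux may also have entries `0`, hence the condition of positivity.) -/
def tableauxOfContent (Y : YoungDiagram) (d : ℕ+ →₀ ℕ) : Set (SemistandardYoungTableau Y) :=
  {T | (∀ c ∈ Y.cells, 0 < T c.1 c.2) ∧
    ∀ i : ℕ+, (Y.cells.filter fun c => T c.1 c.2 = (i : ℕ)).card = d i}

/-- There are only finitely many tableaux of given shape and content, so that counting them by
`Set.ncard` is meaningful. -/
theorem tableauxOfContent_finite (Y : YoungDiagram) (d : ℕ+ →₀ ℕ) :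
    (tableauxOfContent Y d).Finite := by
  classical
  let S : Finset ℕ := d.support.image (fun i : ℕ+ => (i : ℕ))
  have hmem : ∀ T ∈ tableauxOfContent Y d, ∀ c ∈ Y.cells, T c.1 c.2 ∈ S := by
    rintro T ⟨hpos, hd⟩ c hc
    obtain ⟨p, hp⟩ : ∃ p : ℕ+, T c.1 c.2 = (p : ℕ) := ⟨(T c.1 c.2).toPNat (hpos c hc), rfl⟩
    refine Finset.mem_image.mpr ⟨p, ?_, hp.symm⟩
    rw [Finsupp.mem_support_iff, ← hd]
    exact Finset.card_ne_zero_of_mem (Finset.mem_filter.mpr ⟨hc, hp⟩)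
  have hinj : Function.Injective
      (fun (T : tableauxOfContent Y d) (c : Y.cells) =>
        (⟨T.1 c.1.1 c.1.2, hmem T.1 T.2 c.1 c.2⟩ : S)) := by
    intro T T' h
    refine Subtype.ext (SemistandardYoungTableau.ext fun i j => ?_)
    by_cases hij : (i, j) ∈ Y.cells
    · exact congrArg Subtype.val (congrFun h ⟨(i, j), hij⟩)
    · rw [T.1.zeros fun hc => hij hc, T'.1.zeros fun hc => hij hc]
  exact Finite.of_injective _ hinj

/-- The Schur function `s_α = ∑ T, x^T` as a formal power series in `x_1, x_2, …`, where the sum is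
over all semistandard Young tableaux of shape `α`: the coefficient of the monomial `∏ i, x_i ^ d i`
is the number of tableaux `T` with `x^T` equal to it. By convention `s_α = 0` if the sequence `α` is
not a partition. -/
noncomputable def schur {k : ℕ} (α : Fin k → ℤ) : MvPowerSeries ℕ+ ℤ :=
  open Classical in
  fun d => if h : IsPartition α then ((tableauxOfContent h.shape d).ncard : ℤ) else 0

/-- The specialization `x_i = 0` for all `i ∉ A`: every monomial that involves a variable outside of
`A` is deleted. -/
noncomputable def restrictVars (A : Set ℕ+) (f : MvPowerSeries ℕ+ ℤ) : MvPowerSeries ℕ+ ℤ :=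
  open Classical in
  fun d => if (d.support : Set ℕ+) ⊆ A then MvPowerSeries.coeff d f else 0

/-- The Schur function `s_α^A`, obtained from `s_α` by setting `x_i = 0` for all `i ∉ A`. -/
noncomputable def schurOn (A : Set ℕ+) {k : ℕ} (α : Fin k → ℤ) : MvPowerSeries ℕ+ ℤ :=
  restrictVars A (schur α)

/-! By Jacobi–Trudi, `s_α = det (h_{α_i-i+j})` for every weakly decreasing integer sequence: if its
last entry is negative, the last row vanishes, in accordance with the convention `s_α = 0`. In terms
of `β_i = λ_i - i`, the shorter sequences arise by deleting one entry of `β`, up to a shift by `1`.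
Let `h'` be `h` without `x_1`. Since `h_r = h'_r + x_1 h_{r-1}`, row operations on the transposed
matrix replace `h` by `h'` in all rows but the first. The six factors then become brackets on common
rows `W`, and the theorem is the three-term Plücker relation `bracket_mul_bracket` with a unit
vector as one of its four vectors.

For Jacobi–Trudi (`schurOn_eq_det`), both sides obey the same branching rule for the largest
variable. On tableaux, the cells with the largest entry form a horizontal strip; on determinants,
one expands each row as a telescoping sum. Induction settles finite sets of variables, and
comparison of coefficients settles arbitrary ones. -/

/-! ### Removing the largest entry from tableaux -/

/-- The restriction of a tableau to a smaller Young diagram. -/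
def SemistandardYoungTableau.restrict {Y Z : YoungDiagram} (h : Y ≤ Z)
    (T : SemistandardYoungTableau Z) : SemistandardYoungTableau Y where
  entry i j := if (i, j) ∈ Y then T i j else 0
  row_weak' {i j1 j2} hj hc := by
    rw [if_pos hc, if_pos (Y.up_left_mem le_rfl hj.le hc)]
    exact T.row_weak hj (h hc)
  col_strict' {i1 i2 j} hi hc := by
    rw [if_pos hc, if_pos (Y.up_left_mem hi.le le_rfl hc)]
    exact T.col_strict hi (h hc)
  zeros' hc := if_neg hc

theorem SemistandardYoungTableau.restrict_apply {Y Z : YoungDiagram} (h : Y ≤ Z)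
    (T : SemistandardYoungTableau Z) (i j : ℕ) :
    T.restrict h i j = if (i, j) ∈ Y then T i j else 0 := rfl

/-- The extension of a tableau by entries `n` along a horizontal strip. -/
def SemistandardYoungTableau.extend {Y Z : YoungDiagram} (h : Y ≤ Z)
    (hstrip : ∀ i j, (i + 1, j) ∈ Z → (i, j) ∈ Y) (n : ℕ)
    (U : SemistandardYoungTableau Y) (hU : ∀ c ∈ Y, U c.1 c.2 < n) :
    SemistandardYoungTableau Z where
  entry i j := if (i, j) ∈ Y then U i j else if (i, j) ∈ Z then n else 0
  row_weak' {i j1 j2} hj hc := by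
    by_cases h2 : (i, j2) ∈ Y
    · rw [if_pos h2, if_pos (Y.up_left_mem le_rfl hj.le h2)]
      exact U.row_weak hj h2
    · rw [if_neg h2, if_pos hc]
      split_ifs with h1 h3
      · exact (hU _ h1).le
      · exact le_rfl
      · exact n.zero_le
  col_strict' {i1 i2 j} hi hc := by
    have h1 : (i1, j) ∈ Y := hstrip _ _ (Z.up_left_mem hi le_rfl hc)
    rw [if_pos h1]
    split_ifs with h2
    · exact U.col_strict hi h2
    · exact hU _ h1
  zeros' hc := by rw [if_neg fun h' => hc (h h'), if_neg hc]

theorem SemistandardYoungTableau.extend_apply {Y Z : YoungDiagram} (h : Y ≤ Z)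
    (hstrip : ∀ i j, (i + 1, j) ∈ Z → (i, j) ∈ Y) (n : ℕ)
    (U : SemistandardYoungTableau Y) (hU : ∀ c ∈ Y, U c.1 c.2 < n) (i j : ℕ) :
    U.extend h hstrip n hU i j = if (i, j) ∈ Y then U i j else if (i, j) ∈ Z then n else 0 := rfl

/-- Every entry of a tableau of content `d` lies in the support of `d`. -/
theorem exists_mem_support_of_mem_tableauxOfContent {Y : YoungDiagram} {d : ℕ+ →₀ ℕ}
    {T : SemistandardYoungTableau Y} (hT : T ∈ tableauxOfContent Y d) {c : ℕ × ℕ} (hc : c ∈ Y) :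
    ∃ p ∈ d.support, T c.1 c.2 = (p : ℕ) := by
  refine ⟨(T c.1 c.2).toPNat (hT.1 c hc), ?_, rfl⟩
  rw [Finsupp.mem_support_iff, ← hT.2]
  exact Finset.card_ne_zero_of_mem (Finset.mem_filter.mpr ⟨hc, rfl⟩)

/-- If `U` consists of the entries of `T` smaller than the maximal entry `n`, the contents of `T`
and `U` determine each other. -/
theorem mem_tableauxOfContent_iff {Y Z : YoungDiagram} (h : Y ≤ Z) (d : ℕ+ →₀ ℕ) (n : ℕ+)
    (T : SemistandardYoungTableau Z) (U : SemistandardYoungTableau Y)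
    (hTU : ∀ c ∈ Y, T c.1 c.2 = U c.1 c.2) (hle : ∀ c ∈ Z, T c.1 c.2 ≤ n)
    (hY : ∀ c ∈ Z, T c.1 c.2 < n ↔ c ∈ Y) :
    T ∈ tableauxOfContent Z d ↔
      d n + Y.card = Z.card ∧ U ∈ tableauxOfContent Y (d.erase n) := by
  have hpos : (∀ c ∈ Z.cells, 0 < T c.1 c.2) ↔ ∀ c ∈ Y.cells, 0 < U c.1 c.2 := by
    refine ⟨fun H c hc => hTU c hc ▸ H c (h hc), fun H c hc => ?_⟩
    by_cases hcY : c ∈ Y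
    · exact (hTU c hcY).symm ▸ H c hcY
    · exact n.pos.trans_le (not_lt.mp fun h' => hcY ((hY c hc).mp h'))
  have hUn : (Y.cells.filter fun c => U c.1 c.2 = (n : ℕ)).card = 0 := by
    rw [Finset.card_eq_zero, Finset.filter_eq_empty_iff]
    intro c hc h'
    have := (hY c (h hc)).mpr hc
    rw [hTU c hc] at this
    omega
  have hTn : (Z.cells.filter fun c => T c.1 c.2 = (n : ℕ)).card + Y.card = Z.card := by
    have : (Z.cells.filter fun c => T c.1 c.2 = (n : ℕ)) = Z.cells \ Y.cells := by
      ext c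
      rw [Finset.mem_filter, Finset.mem_sdiff]
      refine and_congr_right fun hc => ?_
      have h1 := hY c hc
      have h2 := hle c hc
      rw [YoungDiagram.mem_cells, ← h1]
      omega
    rw [this]
    exact Finset.card_sdiff_add_card_eq_card h
  have hne : ∀ i : ℕ+, i ≠ n → (Z.cells.filter fun c => T c.1 c.2 = (i : ℕ)) =
      Y.cells.filter fun c => U c.1 c.2 = (i : ℕ) := by
    intro i hi
    have hi' : (i : ℕ) ≠ n := fun h' => hi (PNat.coe_injective h')
    ext c
    rw [Finset.mem_filter, Finset.mem_filter]
    constructor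
    · rintro ⟨hc, hci⟩
      have hcY : c ∈ Y := (hY c hc).mp (lt_of_le_of_ne (hle c hc) (hci ▸ hi'))
      exact ⟨hcY, hTU c hcY ▸ hci⟩
    · rintro ⟨hc, hci⟩
      exact ⟨h hc, (hTU c hc).trans hci⟩
  constructor
  · rintro ⟨h1, h2⟩
    refine ⟨by rw [← h2]; exact hTn, hpos.mp h1, fun i => ?_⟩
    by_cases hi : i = n
    · rw [hi, hUn, Finsupp.erase_same]
    · rw [← hne i hi, h2, Finsupp.erase_ne hi]
  · rintro ⟨h0, h1, h2⟩
    refine ⟨hpos.mpr h1, fun i => ?_⟩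
    by_cases hi : i = n
    · rw [hi]; omega
    · rw [hne i hi, h2, Finsupp.erase_ne hi]

/-- The tableaux of shape `Z` with maximal entry at most `n` whose entries smaller than `n` fill the
diagram `Y` correspond to tableaux of shape `Y` if `Z / Y` is a horizontal strip. -/
theorem ncard_tableauxOfContent_filter {Y Z : YoungDiagram} (h : Y ≤ Z)
    (hstrip : ∀ i j, (i + 1, j) ∈ Z → (i, j) ∈ Y) (d : ℕ+ →₀ ℕ) (n : ℕ+)
    (hd : ∀ i ∈ d.support, i ≤ n) :
    {T ∈ tableauxOfContent Z d | ∀ c ∈ Z, T c.1 c.2 < n ↔ c ∈ Y}.ncard =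
      if d n + Y.card = Z.card then (tableauxOfContent Y (d.erase n)).ncard else 0 := by
  have hle : ∀ T ∈ tableauxOfContent Z d, ∀ c ∈ Z, T c.1 c.2 ≤ n := by
    intro T hT c hc
    obtain ⟨p, hp, hpT⟩ := exists_mem_support_of_mem_tableauxOfContent hT hc
    exact hpT ▸ hd p hp
  have hres : ∀ T : SemistandardYoungTableau Z, ∀ c ∈ Y,
      T c.1 c.2 = T.restrict h c.1 c.2 := fun T c hc => by
    rw [SemistandardYoungTableau.restrict_apply, if_pos hc]
  split_ifs with hcard
  · refine Set.ncard_congr (fun T _ => T.restrict h) ?_ ?_ ?_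
    · rintro T ⟨hT, hY⟩
      exact ((mem_tableauxOfContent_iff h d n T _ (hres T) (hle T hT) hY).mp hT).2
    · rintro T T' ⟨hT, hY⟩ ⟨hT', hY'⟩ heq
      refine SemistandardYoungTableau.ext fun i j => ?_
      by_cases hZ : (i, j) ∈ Z
      · by_cases hcY : (i, j) ∈ Y
        · have := hres T (i, j) hcY
          rw [heq, ← hres T' (i, j) hcY] at this
          exact this
        · have h1 := hle T hT _ hZ
          have h2 := hle T' hT' _ hZ
          have h3 := mt (hY _ hZ).mp hcY
          have h4 := mt (hY' _ hZ).mp hcY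
          dsimp only at h1 h2 h3 h4
          omega
      · rw [T.zeros hZ, T'.zeros hZ]
    · intro U hU
      have hUn : ∀ c ∈ Y, U c.1 c.2 < n := by
        intro c hc
        obtain ⟨p, hp, hpU⟩ := exists_mem_support_of_mem_tableauxOfContent hU hc
        rw [Finsupp.support_erase, Finset.mem_erase] at hp
        exact hpU ▸ lt_of_le_of_ne (hd p hp.2) (PNat.coe_injective.ne hp.1)
      have hext : ∀ c ∈ Y, U.extend h hstrip n hUn c.1 c.2 = U c.1 c.2 := fun c hc => by
        rw [SemistandardYoungTableau.extend_apply, if_pos hc]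
      have hext' : ∀ c ∈ Z, c ∉ Y → U.extend h hstrip n hUn c.1 c.2 = n := fun c hc hc' => by
        rw [SemistandardYoungTableau.extend_apply, if_neg hc', if_pos hc]
      have hle' : ∀ c ∈ Z, U.extend h hstrip n hUn c.1 c.2 ≤ n := by
        intro c hc
        by_cases hcY : c ∈ Y
        · exact hext c hcY ▸ (hUn c hcY).le
        · exact (hext' c hc hcY).le
      have hY' : ∀ c ∈ Z, U.extend h hstrip n hUn c.1 c.2 < n ↔ c ∈ Y := by
        intro c hc
        refine ⟨fun h' => ?_, fun hcY => hext c hcY ▸ hUn c hcY⟩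
        by_contra hcY
        exact (hext' c hc hcY ▸ h').false
      refine ⟨U.extend h hstrip n hUn, ⟨?_, hY'⟩, ?_⟩
      · exact (mem_tableauxOfContent_iff h d n _ U hext hle' hY').mpr ⟨hcard, hU⟩
      · refine SemistandardYoungTableau.ext fun i j => ?_
        rw [SemistandardYoungTableau.restrict_apply]
        split_ifs with hc
        · exact hext (i, j) hc
        · exact (U.zeros hc).symm
  · rw [Set.ncard_eq_zero ((tableauxOfContent_finite Z d).subset (Set.sep_subset _ _)),
      Set.eq_empty_iff_forall_notMem]
    rintro T ⟨hT, hY⟩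
    exact hcard ((mem_tableauxOfContent_iff h d n T _ (hres T) (hle T hT) hY).mp hT).1

/-! ### Interlacing sequences and the branching rule for tableau counts -/

theorem IsPartition.mem_shape {k : ℕ} {α : Fin k → ℤ} (h : IsPartition α) {i j : ℕ} :
    (i, j) ∈ h.shape ↔ ∃ hi : i < k, (j : ℤ) < α ⟨i, hi⟩ := by
  rw [IsPartition.shape, YoungDiagram.mem_ofRowLens]
  simp only [List.length_ofFn, List.getElem_ofFn]
  exact exists_congr fun hi => Int.lt_toNat

theorem IsPartition.card_shape {k : ℕ} {α : Fin k → ℤ} (h : IsPartition α) :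
    h.shape.card = ∑ i, (α i).toNat := by
  have : h.shape.card = (Finset.univ.sigma fun i : Fin k => Finset.range (α i).toNat).card := by
    symm
    refine Finset.card_bij (fun p _ => ((p.1 : ℕ), p.2)) ?_ ?_ ?_
    · rintro ⟨i, j⟩ hp
      rw [Finset.mem_sigma, Finset.mem_range, Int.lt_toNat] at hp
      exact h.mem_shape.mpr ⟨i.2, hp.2⟩
    · rintro ⟨i, j⟩ _ ⟨i', j'⟩ _ heq
      rw [Prod.mk.injEq] at heq
      obtain ⟨h1, h2⟩ := heq
      obtain rfl := Fin.ext h1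
      obtain rfl := h2
      rfl
    · rintro ⟨i, j⟩ hc
      obtain ⟨hi, hj⟩ := h.mem_shape.mp hc
      exact ⟨⟨⟨i, hi⟩, j⟩, by simpa using hj, rfl⟩
  rw [this, Finset.card_sigma]
  simp only [Finset.card_range]

/-- The entry following `α i`, or `0` for the last entry. -/
def nextPart {k : ℕ} (α : Fin k → ℤ) (i : Fin k) : ℤ :=
  if h : (i : ℕ) + 1 < k then α ⟨i + 1, h⟩ else 0

/-- The sequences `μ` for which `α / μ` is a horizontal strip. -/
noncomputable def interlacing {k : ℕ} (α : Fin k → ℤ) : Finset (Fin k → ℤ) :=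
  Fintype.piFinset fun i => Finset.Icc (nextPart α i) (α i)

theorem mem_interlacing {k : ℕ} {α μ : Fin k → ℤ} :
    μ ∈ interlacing α ↔ ∀ i, nextPart α i ≤ μ i ∧ μ i ≤ α i := by
  simp [interlacing]

theorem IsPartition.nextPart_nonneg {k : ℕ} {α : Fin k → ℤ} (h : IsPartition α) (i : Fin k) :
    0 ≤ nextPart α i := by
  unfold nextPart
  split_ifs
  · exact h.2 _
  · exact le_rfl

theorem IsPartition.of_mem_interlacing {k : ℕ} {α μ : Fin k → ℤ} (h : IsPartition α)
    (hμ : μ ∈ interlacing α) : IsPartition μ := by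
  rw [mem_interlacing] at hμ
  refine ⟨fun i j hij => ?_, fun i => (h.nextPart_nonneg i).trans (hμ i).1⟩
  rcases hij.eq_or_lt with rfl | hlt
  · exact le_rfl
  have hlt' : (i : ℕ) < j := hlt
  have hi : (i : ℕ) + 1 < k := by omega
  refine (hμ j).2.trans (le_trans ?_ (hμ i).1)
  rw [nextPart, dif_pos hi]
  exact h.1 (Fin.mk_le_of_le_val (by simpa using hlt'))

theorem exists_lt_iff_of_downward_closed {p : ℕ → Prop} (N : ℕ) (hN : ∀ j, p j → j < N)
    (hp : ∀ i j, i ≤ j → p j → p i) : ∃ c, ∀ j, j < c ↔ p j := by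
  classical
  have hex : ∃ j, ¬ p j := ⟨N, fun h => (hN N h).false⟩
  refine ⟨Nat.find hex, fun j => ⟨fun hj => not_not.mp (Nat.find_min hex hj), fun hj => ?_⟩⟩
  by_contra hle
  exact Nat.find_spec hex (hp _ _ (not_lt.mp hle) hj)

theorem int_eq_of_natCast_lt_iff {a b : ℤ} (ha : 0 ≤ a) (hb : 0 ≤ b)
    (h : ∀ j : ℕ, (j : ℤ) < a ↔ (j : ℤ) < b) : a = b := by
  have h1 := h a.toNat
  have h2 := h b.toNat
  omega

/-- The entries smaller than the maximal entry `n` form a tableau whose shape differs from the given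
shape by a horizontal strip. -/
theorem exists_interlacing_of_mem_tableauxOfContent {k : ℕ} {α : Fin k → ℤ} (h : IsPartition α)
    {d : ℕ+ →₀ ℕ} {n : ℕ+} (hd : ∀ i ∈ d.support, i ≤ n)
    {T : SemistandardYoungTableau h.shape} (hT : T ∈ tableauxOfContent h.shape d) :
    ∃ μ ∈ interlacing α, ∀ i : Fin k, ∀ j : ℕ, (j : ℤ) < μ i ↔ (j : ℤ) < α i ∧ T i j < n := by
  have hrow : ∀ i : Fin k, ∃ c : ℕ, ∀ j, j < c ↔ (j : ℤ) < α i ∧ T i j < n := by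
    intro i
    refine exists_lt_iff_of_downward_closed (α i).toNat (fun j hj => Int.lt_toNat.mpr hj.1) ?_
    rintro j1 j2 hj ⟨h1, h2⟩
    refine ⟨by omega, ?_⟩
    rcases hj.eq_or_lt with rfl | hlt
    · exact h2
    · exact (T.row_weak hlt (h.mem_shape.mpr ⟨i.2, h1⟩)).trans_lt h2
  choose c hc using hrow
  refine ⟨fun i => c i, mem_interlacing.mpr fun i => ⟨?_, ?_⟩, fun i j => ?_⟩
  · unfold nextPart
    split_ifs with hi
    -- Otherwise `(i + 1, c i)` is a cell with entry at most `n`, so the entry above it is smaller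
    -- than `n` and would be counted by `c i`.
    · by_contra hlt
      rw [not_le] at hlt
      refine absurd ((hc i (c i)).mpr ⟨hlt.trans_le (h.1 ?_), ?_⟩) (lt_irrefl _)
      · exact Fin.le_def.mpr (Nat.le_succ _)
      · have hmem : ((i : ℕ) + 1, c i) ∈ h.shape := h.mem_shape.mpr ⟨hi, hlt⟩
        obtain ⟨p, hp, hpT⟩ := exists_mem_support_of_mem_tableauxOfContent hT hmem
        refine (T.col_strict (Nat.lt_succ_self (i : ℕ)) hmem).trans_le ?_
        exact hpT.le.trans (hd p hp)
    · exact Int.natCast_nonneg _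
  · by_contra hlt
    rw [not_le] at hlt
    have h0 := h.2 i
    have h1 := (hc i (α i).toNat).mp (by omega)
    omega
  · rw [Nat.cast_lt, hc]

/-- The branching rule for the numbers of tableaux of given shape and content. -/
theorem IsPartition.ncard_tableauxOfContent_eq_sum {k : ℕ} {α : Fin k → ℤ} (h : IsPartition α)
    (d : ℕ+ →₀ ℕ) (n : ℕ+) (hd : ∀ i ∈ d.support, i ≤ n) :
    (tableauxOfContent h.shape d).ncard = ∑ μ : interlacing α,
      if d n = ∑ i, (α i - μ.1 i).toNat then
        (tableauxOfContent (h.of_mem_interlacing μ.2).shape (d.erase n)).ncard else 0 := by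
  have hfib : ∀ μ : interlacing α,
      {T ∈ tableauxOfContent h.shape d | ∀ c ∈ h.shape,
        T c.1 c.2 < n ↔ c ∈ (h.of_mem_interlacing μ.2).shape}.ncard =
      if d n = ∑ i, (α i - μ.1 i).toNat then
        (tableauxOfContent (h.of_mem_interlacing μ.2).shape (d.erase n)).ncard else 0 := by
    rintro ⟨μ, hμ⟩
    have hμ' := mem_interlacing.mp hμ
    rw [ncard_tableauxOfContent_filter _ _ d n hd]
    · refine if_congr ?_ rfl rfl
      have : ∑ i, (α i - μ i).toNat + ∑ i, (μ i).toNat = ∑ i, (α i).toNat := by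
        rw [← Finset.sum_add_distrib]
        refine Finset.sum_congr rfl fun i _ => ?_
        have := hμ' i
        have := h.nextPart_nonneg i
        omega
      rw [IsPartition.card_shape, IsPartition.card_shape, ← this]
      exact Nat.add_right_cancel_iff
    · rintro ⟨i, j⟩ hc
      obtain ⟨hi, hj⟩ := (h.of_mem_interlacing hμ).mem_shape.mp hc
      exact h.mem_shape.mpr ⟨hi, hj.trans_le (hμ' _).2⟩
    · intro i j hc
      obtain ⟨hi, hj⟩ := h.mem_shape.mp hc
      refine (h.of_mem_interlacing hμ).mem_shape.mpr ⟨by omega, hj.trans_le ?_⟩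
      have := (hμ' ⟨i, by omega⟩).1
      rwa [nextPart, dif_pos hi] at this
  rw [← Finset.sum_congr rfl fun μ _ => hfib μ]
  have hunion : tableauxOfContent h.shape d = ⋃ μ : interlacing α,
      {T ∈ tableauxOfContent h.shape d | ∀ c ∈ h.shape,
        T c.1 c.2 < n ↔ c ∈ (h.of_mem_interlacing μ.2).shape} := by
    ext T
    rw [Set.mem_iUnion]
    refine ⟨fun hT => ?_, fun ⟨μ, hT⟩ => hT.1⟩
    obtain ⟨μ, hμ, H⟩ := exists_interlacing_of_mem_tableauxOfContent h hd hT
    refine ⟨⟨μ, hμ⟩, hT, ?_⟩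
    rintro ⟨i, j⟩ hc
    obtain ⟨hi, hj⟩ := h.mem_shape.mp hc
    rw [IsPartition.mem_shape]
    have := H ⟨i, hi⟩ j
    exact ⟨fun h' => ⟨hi, this.mpr ⟨hj, h'⟩⟩, fun ⟨_, h'⟩ => (this.mp h').2⟩
  conv_lhs => rw [hunion]
  rw [Set.ncard_iUnion_of_finite, finsum_eq_sum_of_fintype]
  · exact fun μ => (tableauxOfContent_finite _ d).subset (Set.sep_subset _ _)
  · rintro ⟨μ, hμ⟩ ⟨μ', hμ'⟩ hne
    rw [Function.onFun, Set.disjoint_left]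
    rintro T ⟨hT, H⟩ ⟨_, H'⟩
    refine hne (Subtype.ext (funext fun i => ?_))
    refine int_eq_of_natCast_lt_iff ((h.of_mem_interlacing hμ).2 i)
      ((h.of_mem_interlacing hμ').2 i) fun j => ?_
    by_cases hj : (j : ℤ) < α i
    · have h1 := (H (i, j) (h.mem_shape.mpr ⟨i.2, hj⟩)).symm.trans
        (H' (i, j) (h.mem_shape.mpr ⟨i.2, hj⟩))
      rw [IsPartition.mem_shape, IsPartition.mem_shape] at h1
      simpa using h1
    · have h1 := ((mem_interlacing.mp hμ) i).2
      have h2 := ((mem_interlacing.mp hμ') i).2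
      dsimp only
      omega

/-! ### Setting variables to zero -/

theorem coeff_restrictVars (A : Set ℕ+) (f : MvPowerSeries ℕ+ ℤ) (d : ℕ+ →₀ ℕ) :
    MvPowerSeries.coeff d (restrictVars A f) =
      open Classical in if (d.support : Set ℕ+) ⊆ A then MvPowerSeries.coeff d f else 0 := rfl

theorem Finsupp.support_add_subset_iff (a b : ℕ+ →₀ ℕ) (A : Set ℕ+) :
    ((a + b).support : Set ℕ+) ⊆ A ↔ (a.support : Set ℕ+) ⊆ A ∧ (b.support : Set ℕ+) ⊆ A := by
  have : ((a + b).support : Set ℕ+) = a.support ∪ b.support := by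
    ext i
    simp [imp_iff_not_or]
  rw [this, Finset.coe_union, Set.union_subset_iff]

/-- Setting the variables outside of `A` to zero, as a ring homomorphism. -/
noncomputable def restrictHom (A : Set ℕ+) : MvPowerSeries ℕ+ ℤ →+* MvPowerSeries ℕ+ ℤ where
  toFun := restrictVars A
  map_one' := by
    classical
    ext d
    rw [coeff_restrictVars, MvPowerSeries.coeff_one]
    by_cases hd : d = 0
    · simp [hd]
    · simp [hd]
  map_zero' := by
    ext d
    rw [coeff_restrictVars]
    simp
  map_add' f g := by
    ext d
    simp only [map_add, coeff_restrictVars]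
    split_ifs <;> simp
  map_mul' f g := by
    classical
    ext d
    simp only [MvPowerSeries.coeff_mul, coeff_restrictVars]
    split_ifs with hd
    · refine Finset.sum_congr rfl fun p hp => ?_
      rw [← Finset.HasAntidiagonal.mem_antidiagonal.mp hp, Finsupp.support_add_subset_iff] at hd
      rw [if_pos hd.1, if_pos hd.2]
    · symm
      refine Finset.sum_eq_zero fun p hp => ?_
      rw [← Finset.HasAntidiagonal.mem_antidiagonal.mp hp, Finsupp.support_add_subset_iff, not_and_or] at hd
      rcases hd with hd | hd
      · rw [if_neg hd, zero_mul]
      · rw [if_neg hd, mul_zero]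

theorem restrictHom_apply (A : Set ℕ+) (f : MvPowerSeries ℕ+ ℤ) :
    restrictHom A f = restrictVars A f := rfl

theorem restrictVars_restrictVars (A B : Set ℕ+) (f : MvPowerSeries ℕ+ ℤ) :
    restrictVars A (restrictVars B f) = restrictVars (B ∩ A) f := by
  ext d
  by_cases hA : (d.support : Set ℕ+) ⊆ A <;> by_cases hB : (d.support : Set ℕ+) ⊆ B <;>
    simp [coeff_restrictVars, Set.subset_inter_iff, hA, hB]

theorem restrictVars_univ (f : MvPowerSeries ℕ+ ℤ) : restrictVars Set.univ f = f := by
  ext d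
  rw [coeff_restrictVars, if_pos (Set.subset_univ _)]

theorem schurOn_univ {k : ℕ} (α : Fin k → ℤ) : schurOn Set.univ α = schur α :=
  restrictVars_univ _

/-- A power series is determined by its restrictions to finitely many variables. -/
theorem eq_of_restrictVars_Iic_eq {f g : MvPowerSeries ℕ+ ℤ}
    (h : ∀ N : ℕ+, restrictVars (Set.Iic N) f = restrictVars (Set.Iic N) g) : f = g := by
  ext d
  obtain ⟨N, hN⟩ := d.support.bddAbove
  replace hN : (d.support : Set ℕ+) ⊆ Set.Iic N := hN
  have := congrArg (MvPowerSeries.coeff d) (h N)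
  rwa [coeff_restrictVars, coeff_restrictVars, if_pos hN, if_pos hN] at this

/-! ### Complete homogeneous symmetric functions -/

/-- The complete homogeneous symmetric function `h_r` in the variables `x_i` with `i ∈ A`. -/
noncomputable def completeOn (A : Set ℕ+) (r : ℤ) : MvPowerSeries ℕ+ ℤ :=
  open Classical in
  fun d => if (d.support : Set ℕ+) ⊆ A ∧ (d.degree : ℤ) = r then 1 else 0

theorem coeff_completeOn (A : Set ℕ+) (r : ℤ) (d : ℕ+ →₀ ℕ) :
    MvPowerSeries.coeff d (completeOn A r) =
      open Classical in if (d.support : Set ℕ+) ⊆ A ∧ (d.degree : ℤ) = r then 1 else 0 := rfl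

theorem completeOn_of_neg (A : Set ℕ+) {r : ℤ} (hr : r < 0) : completeOn A r = 0 := by
  ext d
  rw [coeff_completeOn, if_neg, map_zero]
  rintro ⟨-, h⟩
  omega

theorem completeOn_empty (r : ℤ) : completeOn ∅ r = if r = 0 then 1 else 0 := by
  classical
  ext d
  rw [coeff_completeOn]
  by_cases hd : d = 0
  · subst hd
    by_cases hr : r = 0
    · simp [hr]
    · simp [hr, Ne.symm hr]
  · rw [if_neg (by simp [hd])]
    split_ifs <;> simp [MvPowerSeries.coeff_one, hd]

theorem restrictVars_completeOn (A B : Set ℕ+) (r : ℤ) :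
    restrictVars A (completeOn B r) = completeOn (B ∩ A) r := by
  ext d
  by_cases hA : (d.support : Set ℕ+) ⊆ A <;> by_cases hB : (d.support : Set ℕ+) ⊆ B <;>
    simp [coeff_restrictVars, coeff_completeOn, Set.subset_inter_iff, hA, hB]

/-- The monomials of degree `r` not involving `x_n` give the first term; the others are `x_n` times
an arbitrary monomial of degree `r - 1`. -/
theorem completeOn_insert {A : Set ℕ+} {n : ℕ+} (hn : n ∉ A) (r : ℤ) :
    completeOn (insert n A) r =
      completeOn A r + MvPowerSeries.X n * completeOn (insert n A) (r - 1) := by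
  classical
  ext d
  rw [map_add, MvPowerSeries.X, MvPowerSeries.coeff_monomial_mul]
  simp only [coeff_completeOn, one_mul]
  by_cases hd : d n = 0
  · have hle : ¬ Finsupp.single n 1 ≤ d := by
      rw [Finsupp.single_le_iff]
      omega
    rw [if_neg hle, add_zero]
    refine if_congr (and_congr_left' ?_) rfl rfl
    rw [Set.subset_insert_iff_of_notMem]
    simpa using hd
  · have hle : Finsupp.single n 1 ≤ d := by
      rw [Finsupp.single_le_iff]
      omega
    rw [if_pos hle, if_neg (c := (d.support : Set ℕ+) ⊆ A ∧ _) (fun h => hn (h.1 (by simpa using hd))), zero_add]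
    obtain ⟨e, rfl⟩ := exists_add_of_le hle
    rw [add_tsub_cancel_left, Finsupp.support_add_subset_iff, map_add, Finsupp.degree_single]
    have : ((Finsupp.single n 1).support : Set ℕ+) ⊆ insert n A := by
      simp
    push_cast
    refine if_congr ?_ rfl rfl
    constructor
    · rintro ⟨⟨_, h1⟩, h2⟩
      exact ⟨h1, by omega⟩
    · rintro ⟨h1, h2⟩
      exact ⟨⟨this, h1⟩, by omega⟩

/-! ### The branching rule for Schur functions -/

theorem coeff_schurOn {k : ℕ} {α : Fin k → ℤ} (h : IsPartition α) (A : Set ℕ+) (d : ℕ+ →₀ ℕ) :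
    MvPowerSeries.coeff d (schurOn A α) =
      open Classical in
      if (d.support : Set ℕ+) ⊆ A then ((tableauxOfContent h.shape d).ncard : ℤ) else 0 := by
  rw [schurOn, coeff_restrictVars]
  congr 1
  exact dif_pos h

theorem schurOn_of_not_isPartition {k : ℕ} {α : Fin k → ℤ} (h : ¬ IsPartition α) (A : Set ℕ+) :
    schurOn A α = 0 := by
  ext d
  rw [schurOn, coeff_restrictVars]
  have : MvPowerSeries.coeff d (schur α) = 0 := dif_neg h
  rw [this, ite_self, map_zero]

/-- The branching rule for Schur functions: removal of the largest variable. -/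
theorem IsPartition.schurOn_insert {k : ℕ} {α : Fin k → ℤ} (h : IsPartition α) {A : Set ℕ+}
    {n : ℕ+} (hn : ∀ i ∈ A, i < n) :
    schurOn (insert n A) α =
      ∑ μ ∈ interlacing α, MvPowerSeries.X n ^ (∑ i, (α i - μ i).toNat) * schurOn A μ := by
  classical
  have hnA : n ∉ A := fun h' => (hn n h').false
  rw [← Finset.sum_coe_sort]
  ext d
  rw [map_sum, coeff_schurOn h]
  have hterm : ∀ μ : interlacing α, MvPowerSeries.coeff d
      (MvPowerSeries.X n ^ (∑ i, (α i - μ.1 i).toNat) * schurOn A μ.1) =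
      if (d.support : Set ℕ+) ⊆ insert n A then
        if d n = ∑ i, (α i - μ.1 i).toNat then
          ((tableauxOfContent (h.of_mem_interlacing μ.2).shape (d.erase n)).ncard : ℤ)
        else 0 else 0 := by
    rintro ⟨μ, hμ⟩
    dsimp only
    generalize ∑ i, (α i - μ i).toNat = e
    rw [MvPowerSeries.X_pow_eq, MvPowerSeries.coeff_monomial_mul, one_mul,
      coeff_schurOn (h.of_mem_interlacing hμ)]
    by_cases hde : d n = e
    · subst hde
      have hle : Finsupp.single n (d n) ≤ d := Finsupp.single_le_iff.mpr le_rfl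
      have herase : d - Finsupp.single n (d n) = d.erase n := by
        ext i
        by_cases hi : i = n
        · simp [hi]
        · simp [Finsupp.erase_ne hi, Finsupp.single_eq_of_ne hi]
      rw [if_pos hle, if_pos rfl, herase]
      refine if_congr ?_ rfl rfl
      rw [Finsupp.support_erase, Finset.coe_erase, Set.sdiff_singleton_subset_iff]
    · rw [if_neg hde, ite_self]
      split_ifs with hle hs
      -- Here the power of `x_n` is smaller than `d n`, so `n` remains in the support of the
      -- quotient although `n ∉ A`.
      · exfalso
        rw [Finsupp.single_le_iff] at hle
        refine hnA (hs ?_)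
        simp
        omega
      · rfl
      · rfl
  rw [Finset.sum_congr rfl fun μ _ => hterm μ]
  split_ifs with hd
  · rw [h.ncard_tableauxOfContent_eq_sum d n]
    · push_cast
      rfl
    · intro i hi
      rcases hd hi with rfl | hi'
      · exact le_rfl
      · exact (hn i hi').le
  · rw [Finset.sum_const_zero]

/-! ### The Jacobi–Trudi formula -/

/-- The Jacobi–Trudi matrix in the variables `x_i` with `i ∈ A`. -/
noncomputable def jacobiTrudi (A : Set ℕ+) {k : ℕ} (α : Fin k → ℤ) :
    Matrix (Fin k) (Fin k) (MvPowerSeries ℕ+ ℤ) :=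
  Matrix.of fun i j => completeOn A (α i - i + j)

theorem jacobiTrudi_apply (A : Set ℕ+) {k : ℕ} (α : Fin k → ℤ) (i j : Fin k) :
    jacobiTrudi A α i j = completeOn A (α i - i + j) := rfl

/-- Adding a multiple of the following row to each row preserves the determinant. -/
theorem det_add_smul_next {R : Type*} [CommRing R] {k : ℕ} (M : Matrix (Fin k) (Fin k) R)
    (c : Fin k → R) :
    (Matrix.of fun i j => M i j + if h : (i : ℕ) + 1 < k then c i * M ⟨i + 1, h⟩ j else 0).det =
      M.det := by
  -- The row operation is left multiplication by an upper unitriangular matrix.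
  have hU : (Matrix.of fun i j : Fin k =>
      (if i = j then 1 else 0) + if (i : ℕ) + 1 = j then c i else 0).det = 1 := by
    rw [Matrix.det_of_isUpperTriangular]
    · simp
    · intro i j hij
      have hij' : (j : ℕ) < i := hij
      rw [Matrix.of_apply, if_neg (by rintro rfl; omega), if_neg (by omega), add_zero]
  rw [← one_mul M.det, ← hU, ← Matrix.det_mul]
  congr 1
  ext i j
  rw [Matrix.mul_apply]
  simp only [Matrix.of_apply, add_mul, Finset.sum_add_distrib, ite_mul, one_mul, zero_mul,
    Finset.sum_ite_eq, Finset.mem_univ, if_true]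
  congr 1
  split_ifs with h
  · rw [Finset.sum_eq_single ⟨i + 1, h⟩]
    · simp
    · intro b _ hb
      rw [if_neg fun h' => hb (Fin.ext h'.symm)]
    · simp
  · symm
    refine Finset.sum_eq_zero fun b _ => ?_
    rw [if_neg (by omega)]

/-- Telescoping of the recursion `h_r = h'_r + x h_{r-1}`. -/
theorem sum_Icc_pow_mul_completeOn {A : Set ℕ+} {n : ℕ+} (hn : n ∉ A) (b s : ℤ) (N : ℕ) :
    ∑ m ∈ Finset.Icc b (b + N), MvPowerSeries.X n ^ (b + N - m).toNat * completeOn A (m + s) =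
      completeOn (insert n A) (b + N + s) -
        MvPowerSeries.X n ^ (N + 1) * completeOn (insert n A) (b - 1 + s) := by
  induction N with
  | zero =>
    rw [completeOn_insert hn (b + (0 : ℕ) + s)]
    simp [show b + s - 1 = b - 1 + s by ring]
  | succ N ih =>
    have hIcc : Finset.Icc b (b + (N + 1 : ℕ)) =
        insert (b + (N + 1 : ℕ)) (Finset.Icc b (b + N)) := by
      ext m
      simp only [Finset.mem_Icc, Finset.mem_insert]
      omega
    rw [hIcc, Finset.sum_insert (by simp)]
    have hstep : ∀ m ∈ Finset.Icc b (b + N),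
        (MvPowerSeries.X n ^ (b + (N + 1 : ℕ) - m).toNat * completeOn A (m + s) :
          MvPowerSeries ℕ+ ℤ) =
        MvPowerSeries.X n * (MvPowerSeries.X n ^ (b + N - m).toNat * completeOn A (m + s)) := by
      intro m hm
      rw [Finset.mem_Icc] at hm
      rw [show (b + (N + 1 : ℕ) - m).toNat = (b + N - m).toNat + 1 by omega, pow_succ]
      ring
    rw [Finset.sum_congr rfl hstep, ← Finset.mul_sum, ih,
      completeOn_insert hn (b + (N + 1 : ℕ) + s),
      show b + (N + 1 : ℕ) + s - 1 = b + N + s by push_cast; ring, sub_self]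
    simp only [Int.toNat_zero, pow_zero, one_mul]
    ring

/-- The Jacobi–Trudi determinants satisfy the branching rule. -/
theorem IsPartition.det_jacobiTrudi_insert {k : ℕ} {α : Fin k → ℤ} (h : IsPartition α) {A : Set ℕ+}
    {n : ℕ+} (hn : n ∉ A) :
    (jacobiTrudi (insert n A) α).det = ∑ μ ∈ interlacing α,
      MvPowerSeries.X n ^ (∑ i, (α i - μ i).toNat) * (jacobiTrudi A μ).det := by
  have hnext : ∀ i, nextPart α i ≤ α i := by
    intro i
    unfold nextPart
    split_ifs
    · exact h.1 (Fin.le_def.mpr (Nat.le_succ _))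
    · exact h.2 i
  -- Multilinearity turns a determinant whose rows are sums over intervals into a sum over
  -- `interlacing α`.
  have hrow := Matrix.detRowAlternating.toMultilinearMap.map_sum_finset
    (R := MvPowerSeries ℕ+ ℤ)
    (fun (i : Fin k) (m : ℤ) => (MvPowerSeries.X n ^ (α i - m).toNat : MvPowerSeries ℕ+ ℤ) •
      fun j : Fin k => completeOn A (m - i + j))
    (fun i => Finset.Icc (nextPart α i) (α i))
  have hterm : ∀ μ : Fin k → ℤ,
      Matrix.detRowAlternating.toMultilinearMap (fun i =>
        (MvPowerSeries.X n ^ (α i - μ i).toNat : MvPowerSeries ℕ+ ℤ) •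
          fun j : Fin k => completeOn A (μ i - i + j)) =
      MvPowerSeries.X n ^ (∑ i, (α i - μ i).toNat) * (jacobiTrudi A μ).det := by
    intro μ
    rw [MultilinearMap.map_smul_univ, Finset.prod_pow_eq_pow_sum, smul_eq_mul]
    rfl
  rw [Finset.sum_congr rfl fun μ _ => hterm μ] at hrow
  -- The multipliers are the boundary terms of the telescoping sums: `nextPart α i - 1 - i + j` is
  -- `α (i + 1) - (i + 1) + j`, the index in the following row.
  rw [interlacing, ← hrow, ← det_add_smul_next (jacobiTrudi (insert n A) α)
    fun i => - MvPowerSeries.X n ^ ((α i - nextPart α i).toNat + 1)]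
  change _ = Matrix.det _
  congr 1
  ext1 i j
  rw [Finset.sum_apply]
  have htel := sum_Icc_pow_mul_completeOn hn (nextPart α i) (-i + j) (α i - nextPart α i).toNat
  rw [show nextPart α i + (α i - nextPart α i).toNat = α i by have := hnext i; omega] at htel
  simp only [Pi.smul_apply, smul_eq_mul, Matrix.of_apply, jacobiTrudi_apply]
  have hassoc : ∀ m : ℤ, m - i + j = m + (-i + j) := fun m => by ring
  simp only [hassoc]
  rw [htel, sub_eq_add_neg (completeOn _ _), ← neg_mul]
  congr 1
  split_ifs with hi
  · congr 2
    rw [nextPart, dif_pos hi]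
    push_cast
    ring
  -- In the last row the boundary index is `-1 - i + j < 0`, so there is nothing to subtract.
  · rw [nextPart, dif_neg hi, completeOn_of_neg, mul_zero]
    omega

/-- Without variables only `h_0 = 1` survives. Above the diagonal the indices are positive, so the
determinant is the product of the `h_{α_i}`, which is `1` exactly for the empty shape. -/
theorem IsPartition.schurOn_empty {k : ℕ} {α : Fin k → ℤ} (h : IsPartition α) :
    schurOn ∅ α = (jacobiTrudi ∅ α).det := by
  classical
  have hdet : (jacobiTrudi ∅ α).det = if α = 0 then 1 else 0 := by
    rw [Matrix.det_of_isLowerTriangular]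
    · simp only [jacobiTrudi_apply, completeOn_empty, sub_add_cancel]
      rw [Finset.prod_ite_zero, Finset.prod_const_one]
      simp [funext_iff]
    · intro i j hij
      have hij' : (i : ℕ) < j := hij
      rw [jacobiTrudi_apply, completeOn_empty, if_neg]
      have := h.2 i
      omega
  rw [hdet]
  ext d
  rw [coeff_schurOn h]
  by_cases hd : d = 0
  · subst hd
    rw [if_pos (by simp)]
    split_ifs with hα
    · subst hα
      have hmem : ∀ c, c ∉ h.shape := by
        rintro ⟨i, j⟩ hc
        obtain ⟨_, hj⟩ := h.mem_shape.mp hc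
        simp only [Pi.zero_apply] at hj
        omega
      have : tableauxOfContent h.shape 0 = {default} := by
        rw [Set.eq_singleton_iff_unique_mem]
        refine ⟨⟨fun c hc => absurd hc (hmem c), fun i => ?_⟩, fun T _ => ?_⟩
        · rw [Finsupp.zero_apply, Finset.card_eq_zero, Finset.filter_eq_empty_iff]
          exact fun c hc => absurd hc (hmem c)
        · refine SemistandardYoungTableau.ext fun i j => ?_
          rw [T.zeros (hmem _), SemistandardYoungTableau.zeros _ (hmem _)]
      rw [this, Set.ncard_singleton]
      simp
    · obtain ⟨i, hi⟩ := Function.ne_iff.mp hα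
      rw [map_zero, Nat.cast_eq_zero, Set.ncard_eq_zero (tableauxOfContent_finite _ _),
        Set.eq_empty_iff_forall_notMem]
      intro T hT
      have hc : ((i : ℕ), 0) ∈ h.shape :=
        h.mem_shape.mpr ⟨i.2, lt_of_le_of_ne (h.2 i) (Ne.symm hi)⟩
      obtain ⟨p, hp, _⟩ := exists_mem_support_of_mem_tableauxOfContent hT hc
      simp at hp
  · rw [if_neg (by simp [hd])]
    split_ifs <;> simp [MvPowerSeries.coeff_one, hd]

theorem IsPartition.schurOn_eq_det_of_finset {k : ℕ} (A : Finset ℕ+) :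
    ∀ {α : Fin k → ℤ}, IsPartition α → schurOn (A : Set ℕ+) α = (jacobiTrudi A α).det := by
  induction A using Finset.induction_on_max with
  | empty =>
    intro α h
    rw [Finset.coe_empty]
    exact h.schurOn_empty
  | insert n A hn ih =>
    intro α h
    rw [Finset.coe_insert, h.schurOn_insert (n := n) (A := A) hn,
      h.det_jacobiTrudi_insert (fun h' => (hn n h').false)]
    exact Finset.sum_congr rfl fun μ hμ => by rw [ih (h.of_mem_interlacing hμ)]

theorem restrictVars_det_jacobiTrudi (A B : Set ℕ+) {k : ℕ} (α : Fin k → ℤ) :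
    restrictVars A (jacobiTrudi B α).det = (jacobiTrudi (B ∩ A) α).det := by
  rw [← restrictHom_apply, RingHom.map_det]
  congr 1
  ext1 i j
  exact restrictVars_completeOn A B _

/-- The Jacobi–Trudi formula. -/
theorem schurOn_eq_det {k : ℕ} {α : Fin k → ℤ} (hα : Antitone α) (A : Set ℕ+) :
    schurOn A α = (jacobiTrudi A α).det := by
  by_cases h : IsPartition α
  · refine eq_of_restrictVars_Iic_eq fun N => ?_
    have hfin : (A ∩ Set.Iic N).Finite := (Set.finite_Iic N).subset Set.inter_subset_right
    rw [schurOn, restrictVars_restrictVars, restrictVars_det_jacobiTrudi]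
    have := h.schurOn_eq_det_of_finset hfin.toFinset
    rwa [hfin.coe_toFinset] at this
  · rw [schurOn_of_not_isPartition h]
    have : ∃ i, α i < 0 := by
      by_contra! hi
      exact h ⟨hα, hi⟩
    obtain ⟨i, hi⟩ := this
    obtain ⟨k, rfl⟩ : ∃ m, k = m + 1 := ⟨k - 1, by have := i.2; omega⟩
    symm
    -- The last entry of `α` is negative, and the indices in the last row do not exceed it.
    refine Matrix.det_eq_zero_of_row_eq_zero (Fin.last k) fun j => ?_
    rw [jacobiTrudi_apply, completeOn_of_neg]
    have h1 := hα (Fin.le_last i)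
    have h2 := j.is_le
    rw [Fin.val_last]
    omega

/-! ### Brackets and the three-term Plücker relation -/

theorem updateRow_zero_cons {R : Type*} {m n : ℕ} (a b : Fin n → R) (V : Fin m → Fin n → R) :
    (Matrix.of (Fin.cons a V : Fin (m + 1) → Fin n → R)).updateRow 0 b =
      Matrix.of (Fin.cons b V : Fin (m + 1) → Fin n → R) :=
  Fin.update_cons_zero (α := fun _ => Fin n → R) a V b

section Pluecker

variable {R : Type*} [CommRing R]

/-- The determinant of the matrix with rows `a`, `W 0, …, W (p - 1)`, `c`. -/
def bracket {p : ℕ} (a : Fin (p + 2) → R) (W : Fin p → Fin (p + 2) → R) (c : Fin (p + 2) → R) : R :=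
  (Matrix.of (Fin.cons a (Fin.snoc W c : Fin (p + 1) → Fin (p + 2) → R) :
    Fin (p + 2) → Fin (p + 2) → R)).det

/-- The three-term Plücker relation. -/
theorem bracket_mul_bracket {p : ℕ} (a b c e : Fin (p + 2) → R) (W : Fin p → Fin (p + 2) → R) :
    bracket a W c * bracket b W e =
      bracket b W c * bracket a W e + bracket a W b * bracket c W e := by
  set M : Matrix (Fin (p + 2)) (Fin (p + 2)) R :=
    Matrix.of (Fin.cons a (Fin.snoc W c : Fin (p + 1) → Fin (p + 2) → R) :
      Fin (p + 2) → Fin (p + 2) → R) with hM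
  set N : Matrix (Fin (p + 2)) (Fin (p + 2)) R :=
    Matrix.of (Fin.cons 0 (Fin.snoc W e : Fin (p + 1) → Fin (p + 2) → R) :
      Fin (p + 2) → Fin (p + 2) → R) with hN
  -- The linear functional `v ↦ bracket v W e`, written as a Cramer coordinate; it kills every row
  -- of `W`.
  have hφ : ∀ v, N.transpose.cramer v 0 = bracket v W e := by
    intro v
    rw [Matrix.cramer_transpose_apply, bracket]
    exact congrArg Matrix.det (updateRow_zero_cons _ _ _)
  have hφW : ∀ i, bracket (W i) W e = 0 := by
    intro i
    refine Matrix.det_zero_of_row_eq (i := 0) (j := i.castSucc.succ) (Fin.succ_ne_zero _).symm ?_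
    ext j
    simp
  -- Cramer's rule expresses `M.det • b` through the rows of `M`. Under the functional only the
  -- terms of `a` and `c` survive.
  have hcr : ∑ i, (M.updateRow i b).det • M i = M.det • b := by
    have := Matrix.mulVec_cramer M.transpose b
    rw [Matrix.det_transpose] at this
    rw [← this]
    ext j
    simp [Matrix.mulVec, dotProduct, Matrix.cramer_transpose_apply, mul_comm]
  have key := congrArg (fun v => N.transpose.cramer v 0) hcr
  simp only [map_sum, map_smul, Finset.sum_apply, Pi.smul_apply, smul_eq_mul] at key
  simp only [hφ] at key
  rw [Fin.sum_univ_succ, Fin.sum_univ_castSucc] at key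
  have h0 : M.updateRow 0 b = Matrix.of (Fin.cons b (Fin.snoc W c : Fin (p + 1) → _) :
      Fin (p + 2) → Fin (p + 2) → R) := updateRow_zero_cons _ _ _
  have h1 : M.updateRow (Fin.last p).succ b =
      Matrix.of (Fin.cons a (Fin.snoc W b : Fin (p + 1) → _) : Fin (p + 2) → Fin (p + 2) → R) := by
    change Function.update (Fin.cons a (Fin.snoc W c : Fin (p + 1) → _) :
      Fin (p + 2) → Fin (p + 2) → R) _ _ = _
    rw [← Fin.cons_update, Fin.update_snoc_last]
    rfl
  have hM0 : M 0 = a := rfl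
  have hMl : M (Fin.last p).succ = c := by ext j; simp [hM]
  have hMi : ∀ i : Fin p, M i.castSucc.succ = W i := by intro i; ext j; simp [hM]
  rw [h0, h1, hM0, hMl] at key
  simp only [hMi, hφW, mul_zero, Finset.sum_const_zero, zero_add] at key
  exact key.symm

theorem det_snoc {n : ℕ} (V : Fin n → Fin (n + 1) → R) (c : Fin (n + 1) → R) :
    (Matrix.of (Fin.snoc V c : Fin (n + 1) → Fin (n + 1) → R)).det =
      (-1) ^ n * (Matrix.of (Fin.cons c V : Fin (n + 1) → Fin (n + 1) → R)).det := by
  have h := Matrix.det_permute (finRotate (n + 1))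
    (Matrix.of (Fin.cons c V : Fin (n + 1) → Fin (n + 1) → R))
  rw [sign_finRotate, Nat.add_sub_cancel] at h
  push_cast at h
  rw [← h, Fin.snoc_eq_cons_rotate]
  rfl

theorem bracket_eq_neg_one_pow_mul {p : ℕ} (a b : Fin (p + 2) → R) (W : Fin p → Fin (p + 2) → R) :
    bracket a W b = (-1) ^ p * (Matrix.of (Fin.cons a (Fin.cons b W : Fin (p + 1) → _) :
      Fin (p + 2) → Fin (p + 2) → R)).det := by
  rw [bracket, Fin.cons_snoc_eq_snoc_cons, det_snoc, pow_succ, mul_assoc]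
  congr 1
  rw [neg_one_mul, neg_eq_iff_eq_neg]
  have h := Matrix.detRowAlternating.map_swap (R := R)
    (Fin.cons a (Fin.cons b W : Fin (p + 1) → _) : Fin (p + 2) → Fin (p + 2) → R)
    (i := 0) (j := 1) Fin.zero_ne_one
  refine Eq.trans (congrArg Matrix.det ?_) h
  ext i j
  refine Fin.cases ?_ (fun i => Fin.cases ?_ (fun i => ?_) i) i
  · simp
  · simp
  · have : Equiv.swap (0 : Fin (p + 2)) 1 i.succ.succ = i.succ.succ :=
      Equiv.swap_apply_of_ne_of_ne (Fin.succ_ne_zero _)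
        (fun h => Fin.succ_ne_zero i (Fin.succ_injective _ h))
    simp [this]

/-- Laplace expansion along the last row: a unit vector deletes column `t`. -/
theorem bracket_single {p : ℕ} (a : Fin (p + 2) → R) (W : Fin p → Fin (p + 2) → R)
    (t : Fin (p + 2)) :
    bracket a W (Pi.single t 1) = (-1) ^ (p + 1 + (t : ℕ)) *
      (Matrix.of fun i j => (Fin.cons a W : Fin (p + 1) → Fin (p + 2) → R) i
        (t.succAbove j)).det := by
  rw [bracket, Fin.cons_snoc_eq_snoc_cons, Matrix.det_succ_row _ (Fin.last (p + 1)),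
    Finset.sum_eq_single t]
  · simp only [Fin.val_last, Matrix.of_apply, Fin.snoc_last, Pi.single_eq_same, mul_one]
    congr 2
    ext i j
    simp
  · intro j _ hj
    simp [hj]
  · simp

/-! ### The quadratic relation for shifted determinants -/

/-- The determinant with entries `g (β i + j)`. -/
def shiftDet {n : ℕ} (g : ℤ → R) (β : Fin n → ℤ) : R :=
  (Matrix.of fun j i : Fin n => g (β i + (j : ℕ))).det

/-- Subtract `x` times the preceding row from every row except the first. -/
theorem shiftDet_succ {n : ℕ} {g g' : ℤ → R} {x : R} (hg : ∀ r, g r = g' r + x * g (r - 1))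
    (β : Fin (n + 1) → ℤ) :
    shiftDet g β = (Matrix.of (Fin.cons (fun i => g (β i))
      (fun (j : Fin n) i => g' (β i + (j : ℕ) + 1)) :
        Fin (n + 1) → Fin (n + 1) → R)).det := by
  refine Matrix.det_eq_of_forall_row_eq_smul_add_pred (fun _ => x) ?_ ?_
  · intro i
    simp
  · intro i j
    simp only [Matrix.of_apply, Fin.cons_succ, Fin.val_succ, Fin.val_castSucc]
    rw [hg]
    push_cast
    rw [← add_assoc, add_sub_cancel_right]

/-- The quadratic relation between the determinants of two families with
`g r = g' r + x * g (r - 1)`. -/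
theorem shiftDet_mul_shiftDet {n : ℕ} {g g' : ℤ → R} {x : R} (hg : ∀ r, g r = g' r + x * g (r - 1))
    (β : Fin (n + 1) → ℤ) (t : Fin (n + 1)) :
    shiftDet g β * shiftDet g' (fun i => β (t.succAbove i)) =
      shiftDet g' β * shiftDet g (fun i => β (t.succAbove i)) +
        x * shiftDet g (fun i => β i - 1) * shiftDet g' (fun i => β (t.succAbove i) + 1) := by
  cases n with
  | zero => simp [shiftDet, hg (β 0)]
  | succ p =>
    -- The rows `b, W, c` make up the whole matrix of `g'`; by `shiftDet_succ`, exchanging `b` for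
    -- `a` gives the determinant of `g`.
    set a : Fin (p + 2) → R := fun i => g (β i) with ha
    set b : Fin (p + 2) → R := fun i => g' (β i) with hb
    set c : Fin (p + 2) → R := fun i => g' (β i + p + 1) with hc
    set W : Fin p → Fin (p + 2) → R := fun j i => g' (β i + (j : ℕ) + 1) with hW
    set ε : R := (-1) ^ (p + 1 + (t : ℕ)) with hε
    have hWc : (fun (j : Fin (p + 1)) i => g' (β i + (j : ℕ) + 1)) =
        (Fin.snoc W c : Fin (p + 1) → Fin (p + 2) → R) := by
      ext j i
      refine Fin.lastCases ?_ (fun j => ?_) j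
      · simp [hc]
      · simp [hW]
    have h1 : shiftDet g β = bracket a W c := by
      rw [shiftDet_succ hg, hWc]
      rfl
    have h2 : shiftDet g' β = bracket b W c := by
      rw [bracket, ← hWc, shiftDet]
      congr 1
      ext j i
      refine Fin.cases ?_ (fun j => ?_) j
      · simp [hb]
      · simp [add_assoc]
    have h3 : bracket b W (Pi.single t 1) = ε * shiftDet g' (fun i => β (t.succAbove i)) := by
      rw [bracket_single, shiftDet]
      congr 2
      ext j i
      refine Fin.cases ?_ (fun j => ?_) j
      · simp [hb]
      · simp [hW, add_assoc]
    have h4 : bracket a W (Pi.single t 1) = ε * shiftDet g (fun i => β (t.succAbove i)) := by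
      rw [bracket_single, shiftDet_succ hg]
      congr 2
      ext j i
      refine Fin.cases ?_ (fun j => ?_) j
      · simp [ha]
      · simp [hW]
    have h5 : bracket c W (Pi.single t 1) =
        ε * ((-1) ^ p * shiftDet g' (fun i => β (t.succAbove i) + 1)) := by
      have hs : shiftDet g' (fun i => β (t.succAbove i) + 1) = (Matrix.of
          (Fin.snoc (fun j i => W j (t.succAbove i)) (fun i => c (t.succAbove i)) :
            Fin (p + 1) → Fin (p + 1) → R)).det := by
        rw [shiftDet]
        congr 1
        ext j i
        refine Fin.lastCases ?_ (fun j => ?_) j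
        · simp [hc, add_right_comm]
        · simp [hW, add_right_comm]
      rw [bracket_single, hs, det_snoc, ← mul_assoc ((-1) ^ p), ← mul_pow, neg_one_mul, neg_neg,
        one_pow, one_mul]
      congr 2
      ext j i
      refine Fin.cases ?_ (fun j => ?_) j <;> simp
    have h6 : bracket a W b = (-1) ^ p * (x * shiftDet g (fun i => β i - 1)) := by
      rw [bracket_eq_neg_one_pow_mul, shiftDet_succ hg]
      congr 1
      have hbW : (fun (j : Fin (p + 1)) i => g' (β i - 1 + (j : ℕ) + 1)) =
          (Fin.cons b W : Fin (p + 1) → Fin (p + 2) → R) := by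
        ext j i
        refine Fin.cases ?_ (fun j => ?_) j
        · simp [hb]
        · simp only [Fin.val_succ, Fin.cons_succ, hW]
          push_cast
          congr 1
          ring
      rw [hbW]
      -- As `b` is also the second row, only the summand `x • g (β i - 1)` of the first row
      -- contributes, and `shiftDet_succ` for `β - 1` applies.
      have hab : a = b + x • fun i => g (β i - 1) := by
        ext i
        simp [ha, hb, hg (β i)]
      have hadd := Matrix.det_updateRow_add (Matrix.of
        (Fin.cons 0 (Fin.cons b W : Fin (p + 1) → Fin (p + 2) → R) : Fin (p + 2) → Fin (p + 2) → R))
        0 b (x • fun i => g (β i - 1))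
      rw [Matrix.det_updateRow_smul, updateRow_zero_cons, updateRow_zero_cons, updateRow_zero_cons,
        ← hab] at hadd
      rw [hadd, Matrix.det_zero_of_row_eq Fin.zero_ne_one, zero_add]
      rfl
    have key := bracket_mul_bracket a b c (Pi.single t 1) W
    rw [h3, h4, h5, h6] at key
    rw [h1, h2]
    have hεε : ε * ε = 1 := by
      rw [hε, ← mul_pow, neg_one_mul, neg_neg, one_pow]
    have hpp : ((-1) ^ p * (-1) ^ p : R) = 1 := by
      rw [← mul_pow, neg_one_mul, neg_neg, one_pow]
    -- Multiplying by `ε` cancels the sign of the column deletion; the two factors `(-1) ^ p` in the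
    -- last product cancel each other.
    linear_combination ε * key - (bracket a W c * shiftDet g' (fun i => β (t.succAbove i)) -
      bracket b W c * shiftDet g (fun i => β (t.succAbove i)) -
      x * shiftDet g (fun i => β i - 1) * shiftDet g' (fun i => β (t.succAbove i) + 1)) * hεε +
      ε * ε * x * shiftDet g (fun i => β i - 1) *
        shiftDet g' (fun i => β (t.succAbove i) + 1) * hpp

end Pluecker

/-! ### Proof of the theorem -/

theorem det_jacobiTrudi_eq_shiftDet (A : Set ℕ+) {k : ℕ} (α : Fin k → ℤ) :
    (jacobiTrudi A α).det = shiftDet (completeOn A) (fun i => α i - (i : ℕ)) := by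
  rw [← Matrix.det_transpose]
  rfl

theorem completeOn_univ_eq_add (r : ℤ) :
    completeOn Set.univ r =
      completeOn (Set.Ici 2) r + MvPowerSeries.X 1 * completeOn Set.univ (r - 1) := by
  have h : (Set.univ : Set ℕ+) = insert 1 (Set.Ici 2) := by
    ext i
    simp only [Set.mem_univ, Set.mem_insert_iff, Set.mem_Ici, true_iff]
    rcases eq_or_ne i 1 with h | h
    · exact Or.inl h
    · exact Or.inr (PNat.add_one_le_iff.mpr (lt_of_le_of_ne one_le h.symm))
  rw [h]
  exact completeOn_insert (by simp) r

/-- The partition is `lam = (λ_1, …, λ_k)` with `k = m + 1` and `λ_j = lam (j - 1)`. -/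
theorem theorem6p2 (m : ℕ) (lam : Fin (m + 1) → ℤ) (hlam : IsPartition lam)
    (t : ℕ) (ht : t ≤ m)
    (mu nu : Fin m → ℤ) (rho : Fin (m + 1) → ℤ)
    (hmu : mu = fun i : Fin m => if (i : ℕ) < t then lam i.castSucc else lam i.succ - 1)
    (hnu : nu = fun i : Fin m => if (i : ℕ) < t then lam i.castSucc + 1 else lam i.succ)
    (hrho : rho = fun i => lam i - 1) :
    schur lam * schurOn (Set.Ici 2) mu =
      schurOn (Set.Ici 2) lam * schur mu +
        MvPowerSeries.X 1 * schur rho * schurOn (Set.Ici 2) nu := by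
  have hle : ∀ i j : Fin (m + 1), (i : ℕ) ≤ j → lam j ≤ lam i := fun i j hij => hlam.1 hij
  have hmu' : Antitone mu := by
    intro i j hij
    have hij' : (i : ℕ) ≤ j := hij
    have h1 := hle i.castSucc j.castSucc hij'
    have h2 := hle i.succ j.succ (by simpa using hij')
    have h3 := hle i.castSucc j.succ (by simp; omega)
    simp only [hmu]
    split_ifs <;> omega
  have hnu' : Antitone nu := by
    intro i j hij
    have hij' : (i : ℕ) ≤ j := hij
    have h1 := hle i.castSucc j.castSucc hij'
    have h2 := hle i.succ j.succ (by simpa using hij')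
    have h3 := hle i.castSucc j.succ (by simp; omega)
    simp only [hnu]
    split_ifs <;> omega
  have hrho' : Antitone rho := by
    intro i j hij
    have := hlam.1 hij
    simp only [hrho]
    omega
  -- The Jacobi–Trudi formula needs only monotonicity, so negative entries of `mu` or `rho` require
  -- no separate case.
  rw [← schurOn_univ lam, ← schurOn_univ mu, ← schurOn_univ rho]
  simp only [schurOn_eq_det hlam.1, schurOn_eq_det hmu', schurOn_eq_det hnu',
    schurOn_eq_det hrho', det_jacobiTrudi_eq_shiftDet]
  have key := shiftDet_mul_shiftDet completeOn_univ_eq_add (fun i => lam i - ((i : ℕ) : ℤ))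
    ⟨t, by omega⟩
  -- From position `t` on, `succAbove` raises the index by one; this accounts for the `- 1` in `mu`,
  -- and for the missing `+ 1` in `nu` below.
  have e1 : (fun i : Fin m => mu i - ((i : ℕ) : ℤ)) = fun i =>
      lam (Fin.succAbove ⟨t, by omega⟩ i) -
        ((Fin.succAbove (⟨t, by omega⟩ : Fin (m + 1)) i : ℕ) : ℤ) := by
    ext i
    simp only [hmu, Fin.succAbove, Fin.lt_def, Fin.val_castSucc]
    split_ifs
    · simp
    · simp; ring
  have e2 : (fun i : Fin m => nu i - ((i : ℕ) : ℤ)) = fun i =>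
      lam (Fin.succAbove ⟨t, by omega⟩ i) -
        ((Fin.succAbove (⟨t, by omega⟩ : Fin (m + 1)) i : ℕ) : ℤ) + 1 := by
    ext i
    simp only [hnu, Fin.succAbove, Fin.lt_def, Fin.val_castSucc]
    split_ifs
    · simp; ring
    · simp; ring
  have e3 : (fun i => rho i - ((i : ℕ) : ℤ)) = fun i => lam i - ((i : ℕ) : ℤ) - 1 := by
    ext i
    rw [hrho]
    ring
  rw [e1, e2, e3]
  exact key
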